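/- **Theorem 5.1 ($\mathrm{RF}(3,3,o(n))$).** For positive integers $r,k,n$ and a function $f$, let $\mathrm{RF}(r,k,f(n))$ be the maximum, over all graphs $G$ on $n$ vertices with independence number at most $f(n)$, of the number of $r$-edge-colorings of $G$ (that is, maps $E(G)\to\{1,\dots,r\}$) with no monochromatic copy of $K_k$. Then $$\mathrm{RF}(3,3,o(n))=2^{n^2/4+o(n^2)},$$ which means the following: for every $\eta>0$ there is $\varepsilon_0>0$ such that for every $0<\varepsilon\le\varepsilon_0$ there is $n_0$ such that for all $n\ge n_0$ $$2^{n^2/4-\eta n^2}\;\le\;\mathrm{RF}(3,3,\varepsilon n)\;\le\;2^{n^2/4+\eta n^2}.$$ -/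

import Mathlib

/-- The number of `r`-edge-colorings of `G` (arbitrary maps from the edge set to `r` colors)
without a monochromatic copy of `K_k`: for every color `c`, the spanning subgraph formed by the
edges of color `c` contains no clique on `k` vertices. -/
noncomputable def numMonoCliqueFreeColorings {V : Type*} (r k : ℕ) (G : SimpleGraph V) : ℕ :=
  Nat.card {C : G.EdgeLabeling (Fin r) // ∀ c : Fin r, (C.labelGraph c).CliqueFree k}

/-- The values of `numMonoCliqueFreeColorings r k` on `n`-vertex graphs whose independence number
is at most `f n`. -/
def rfValues (r k : ℕ) (f : ℕ → ℝ) (n : ℕ) : Set ℕ :=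
  {N | ∃ G : SimpleGraph (Fin n), (G.indepNum : ℝ) ≤ f n ∧ numMonoCliqueFreeColorings r k G = N}

/-- `RF(r, k, f(n))`: the maximum number of `r`-edge-colorings without a monochromatic `K_k` that
an `n`-vertex graph with independence number at most `f n` can have. -/
noncomputable def RF (r k : ℕ) (f : ℕ → ℝ) (n : ℕ) : ℕ :=
  sSup (rfValues r k f n)

/-- As soon as some `n`-vertex graph has independence number at most `f n`, the number
`RF r k f n` is a genuine maximum. -/
theorem RF_isGreatest (r k : ℕ) (f : ℕ → ℝ) (n : ℕ)
    (h : ∃ G : SimpleGraph (Fin n), (G.indepNum : ℝ) ≤ f n) :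
    IsGreatest (rfValues r k f n) (RF r k f n) := by
  have hfin : (rfValues r k f n).Finite :=
    (Set.finite_range (fun G : SimpleGraph (Fin n) => numMonoCliqueFreeColorings r k G)).subset
      (by rintro N ⟨G, -, rfl⟩; exact ⟨G, rfl⟩)
  obtain ⟨G, hG⟩ := h
  have hne : (rfValues r k f n).Nonempty := ⟨_, G, hG, rfl⟩
  exact ⟨Nat.sSup_mem hne hfin.bddAbove, fun N hN => le_csSup hfin.bddAbove hN⟩

/-! Lower bound: take a triangle-free graph `H` of tiny independence ratio, put disjoint copies of
it on two halves of the vertex set and join the halves completely. Color the inside edges 2 and the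
roughly n²/4 crossing edges freely with 0 and 1; no triangle is monochromatic. Such an `H` is the
graph of nearly antipodal pairs in the cube, where isoperimetry
(`card_mul_card_le_of_le_hammingDist`) bounds independent sets.

Upper bound, without regularity: in each color c, about 1/γ neighborhoods greedily cover almost all
of every c-neighborhood. Vertices covered in all three colors are few, because for a fixed choice of
covering vertices they form an independent set: an edge of color c would close a triangle with the
c-covering vertex. Every other vertex gets a color in which it is uncovered
(`exists_color_assignment`), and then few edges of color c touch the class of c. Apart from these
exceptional edges and those at unassigned vertices, an edge between two classes must have the third
color, and an edge inside class c has color c+1 or c+2. So the coloring is encoded by the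
assignment, small sets of exceptional pairs and one triangle-free graph. These contribute 4^n,
2^{o(n²)} and 2^{n²/4+o(n²)} (Erdős–Kleitman–Rothschild, `exists_numTriangleFree_le_two_rpow`). -/

open Finset

/-! ### Isoperimetry in the discrete cube. -/

theorem hammingDist_cons {n : ℕ} (i j : Bool) (x y : Fin n → Bool) :
    hammingDist (Fin.cons i x : Fin (n + 1) → Bool) (Fin.cons j y) =
      (if i ≠ j then 1 else 0) + hammingDist x y := by
  simp only [hammingDist, Fin.univ_succ, Finset.filter_cons, Finset.filter_map]
  split_ifs <;> simp_all [add_comm]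

theorem card_eq_card_cons_add_card_cons {n : ℕ} (A : Finset (Fin (n + 1) → Bool)) :
    #A = #{x : Fin n → Bool | (Fin.cons false x : Fin (n + 1) → Bool) ∈ A} +
      #{x : Fin n → Bool | (Fin.cons true x : Fin (n + 1) → Bool) ∈ A} := by
  have key : ∀ i : Bool, #{x : Fin n → Bool | (Fin.cons i x : Fin (n + 1) → Bool) ∈ A} =
      #{x ∈ A | x 0 = i} := fun i => by
    refine Finset.card_nbij' (fun x => Fin.cons i x) Fin.tail ?_ ?_ ?_ ?_
    · intro x hx
      simpa using hx
    · intro x hx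
      simp only [coe_filter, Set.mem_ofPred_eq] at hx
      obtain ⟨hx, rfl⟩ := hx
      simpa using hx
    · intro x _
      simp
    · intro x hx
      simp only [coe_filter, Set.mem_ofPred_eq] at hx
      obtain ⟨hx, rfl⟩ := hx
      simp
  rw [key, key, ← Finset.card_filter_add_card_filter_not (s := A) (fun x => x 0 = false)]
  simp

/-- The extreme case is r = 2x, s = x/2. This yields the base 9/2 = 2 + 5/2 of the isoperimetric
bound. -/
theorem add_le_of_mul_le_sq {x r s : ℝ} (hr : r ≤ 2 * x) (hs : s ≤ 2 * x)
    (hr0 : 0 ≤ r) (h : r * s ≤ x ^ 2) : r + s ≤ 5 / 2 * x := by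
  by_contra! hc
  have h1 : 0 ≤ (2 * x - r) * (r - x / 2) := mul_nonneg (by linarith) (by linarith)
  rcases hr0.eq_or_lt with rfl | hr0
  · linarith
  have h3 : 0 < r * (r + s - 5 / 2 * x) := mul_pos hr0 (by linarith)
  nlinarith

/-- Isoperimetry in the discrete cube: two sets at Hamming distance at least `d` cannot both be
large. -/
theorem card_mul_card_le_of_le_hammingDist (n d : ℕ) (A B : Finset (Fin n → Bool))
    (h : ∀ a ∈ A, ∀ b ∈ B, d ≤ hammingDist a b) :
    (#A : ℝ) * #B ≤ (9 / 2) ^ n / 2 ^ d := by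
  induction n generalizing d with
  | zero =>
    rcases A.eq_empty_or_nonempty with rfl | ⟨a, ha⟩
    · simp
    rcases B.eq_empty_or_nonempty with rfl | ⟨b, hb⟩
    · simp
    obtain rfl : d = 0 := by simpa [hammingDist] using h a ha b hb
    have hA : (#A : ℝ) ≤ 1 := by exact_mod_cast A.card_le_univ.trans (by simp)
    have hB : (#B : ℝ) ≤ 1 := by exact_mod_cast B.card_le_univ.trans (by simp)
    simpa using mul_le_one₀ hA (Nat.cast_nonneg _) hB
  | succ n ih =>
    let S : Finset (Fin (n + 1) → Bool) → Bool → Finset (Fin n → Bool) := fun A i =>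
      {x : Fin n → Bool | (Fin.cons i x : Fin (n + 1) → Bool) ∈ A}
    set x : ℝ := (9 / 2) ^ n / 2 ^ d with hx
    have same : ∀ i, (#(S A i) : ℝ) * #(S B i) ≤ x := fun i => ih d _ _ fun a ha b hb => by
      have := h _ (by simpa [S] using ha) _ (by simpa [S] using hb)
      simpa [hammingDist_cons] using this
    have diff : ∀ i j, i ≠ j → (#(S A i) : ℝ) * #(S B j) ≤ 2 * x := fun i j hij => by
      -- Differing first coordinates supply one unit of distance, so distance d - 1 remains, at the
      -- cost of a factor 2. For d = 0 the truncated subtraction only makes the bound better than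
      -- needed.
      refine (ih (d - 1) _ _ fun a ha b hb => ?_).trans ?_
      · have := h _ (by simpa [S] using ha) _ (by simpa [S] using hb)
        simp only [hammingDist_cons, if_pos hij] at this
        omega
      · rw [hx, div_le_iff₀ (by positivity)]
        rcases d with _ | d
        · simp only [zero_tsub, pow_zero, div_one, mul_one]
          have : (0 : ℝ) ≤ (9 / 2) ^ n := by positivity
          linarith
        · rw [Nat.add_sub_cancel, pow_succ]
          field_simp
          rfl
    have hA : (#A : ℝ) = #(S A false) + #(S A true) := by
      exact_mod_cast card_eq_card_cons_add_card_cons A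
    have hB : (#B : ℝ) = #(S B false) + #(S B true) := by
      exact_mod_cast card_eq_card_cons_add_card_cons B
    have hff := same false
    have htt := same true
    have hft := diff false true (by simp)
    have htf := diff true false (by simp)
    -- Regrouping the two cross products into same-coordinate products shows that they cannot both
    -- be near 2x.
    have hprod : ((#(S A false) : ℝ) * #(S B true)) * (#(S A true) * #(S B false)) ≤ x ^ 2 := by
      calc _ = ((#(S A false) : ℝ) * #(S B false)) * (#(S A true) * #(S B true)) := by ring
        _ ≤ x * x := mul_le_mul hff htt (by positivity) (by positivity)
        _ = x ^ 2 := by ring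
    have := add_le_of_mul_le_sq hft htf (by positivity) hprod
    calc (#A : ℝ) * #B ≤ 9 / 2 * x := by rw [hA, hB]; linarith
      _ = (9 / 2) ^ (n + 1) / 2 ^ d := by rw [hx]; ring

theorem hammingDist_not_add_hammingDist {ι : Type*} [Fintype ι] (x y : ι → Bool) :
    hammingDist (fun i => !(x i)) y + hammingDist x y = Fintype.card ι := by
  have : hammingDist (fun i => !(x i)) y = #{i | ¬ x i ≠ y i} := by
    unfold hammingDist
    congr 1
    ext i
    cases hx : x i <;> cases hy : y i <;> simp [hx, hy]
  rw [this, add_comm]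
  exact Finset.card_filter_add_card_filter_not (s := univ) _

theorem hammingDist_not_comm {ι : Type*} [Fintype ι] (x y : ι → Bool) :
    hammingDist x (fun i => !(y i)) = hammingDist (fun i => !(x i)) y := by
  unfold hammingDist
  congr 1
  ext i
  cases hx : x i <;> cases hy : y i <;> simp [hx, hy]

/-! ### Triangle-free graphs of small independence ratio. -/

/-- The graph on the cube `{0,1}^(3k)` joining the points at Hamming distance more than `2k`. -/
def farCubeGraph (k : ℕ) : SimpleGraph (Fin (3 * k) → Bool) where
  Adj x y := 2 * k < hammingDist x y
  symm := ⟨fun x y h => by rwa [hammingDist_comm]⟩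
  loopless := ⟨fun x h => by simp at h⟩

/-- If x and z are both far from y, both lie within distance less than k of its antipode, hence less
than 2k apart. -/
theorem farCubeGraph_cliqueFree (k : ℕ) : (farCubeGraph k).CliqueFree 3 := by
  intro s hs
  obtain ⟨x, y, z, hxy, hxz, hyz, -⟩ := SimpleGraph.is3Clique_iff.1 hs
  simp only [farCubeGraph] at hxy hxz hyz
  have h1 := hammingDist_not_add_hammingDist x y
  have h2 := hammingDist_not_add_hammingDist y z
  have h3 := hammingDist_triangle x (fun i => !(y i)) z
  rw [hammingDist_not_comm] at h3
  simp only [Fintype.card_fin] at h1 h2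
  omega

/-- An independent set and its antipodal image are at distance at least 3k - 2k = k, so isoperimetry
applies to this pair. -/
theorem farCubeGraph_indepNum_sq_le (k : ℕ) :
    ((farCubeGraph k).indepNum : ℝ) ^ 2 ≤ (729 / 16) ^ k := by
  obtain ⟨A, hA⟩ := (farCubeGraph k).exists_isNIndepSet_indepNum
  have hinj : Function.Injective (fun (x : Fin (3 * k) → Bool) i => !(x i)) := fun x y h => by
    ext i
    simpa using congrFun h i
  have := card_mul_card_le_of_le_hammingDist (3 * k) k A (A.image fun x i => !(x i)) <| by
    intro a ha b hb
    obtain ⟨b, hbA, rfl⟩ := Finset.mem_image.1 hb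
    have h1 := hammingDist_not_add_hammingDist a b
    rw [hammingDist_not_comm]
    rw [Fintype.card_fin] at h1
    have h2 : hammingDist a b ≤ 2 * k := by
      rcases eq_or_ne a b with rfl | hab
      · simp
      · exact not_lt.1 (hA.isIndepSet ha hbA hab)
    omega
  rw [Finset.card_image_of_injective _ hinj, hA.card_eq] at this
  calc _ ≤ ((9 / 2) ^ (3 * k) / 2 ^ k : ℝ) := by rw [sq]; exact this
    _ = (729 / 16) ^ k := by rw [pow_mul, ← div_pow]; norm_num

/-- There are triangle-free graphs of arbitrarily small independence ratio. -/
theorem exists_cliqueFree_three_indepNum_le {ε : ℝ} (hε : 0 < ε) :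
    ∃ k : ℕ, ((farCubeGraph k).indepNum : ℝ) ≤ ε * Fintype.card (Fin (3 * k) → Bool) := by
  -- The ratio is 729/16 divided by 64, where 64^k is the square of the number 8^k of vertices.
  obtain ⟨k, hk⟩ := exists_pow_lt_of_lt_one (show 0 < ε ^ 2 by positivity)
    (show (729 / 1024 : ℝ) < 1 by norm_num)
  refine ⟨k, ?_⟩
  refine le_of_sq_le_sq ?_ (by positivity)
  calc _ ≤ (729 / 16 : ℝ) ^ k := farCubeGraph_indepNum_sq_le k
    _ = (729 / 1024) ^ k * 64 ^ k := by rw [← mul_pow]; norm_num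
    _ ≤ ε ^ 2 * 64 ^ k := by gcongr
    _ = _ := by
      simp only [Fintype.card_fun, Fintype.card_bool, Fintype.card_fin]
      push_cast
      rw [mul_pow, ← pow_mul, mul_comm 3 k, mul_assoc, mul_comm k, pow_mul]
      norm_num

/-! ### The lower bound construction. -/

section Construction

variable {V : Type*} [Fintype V] [Nonempty V]

/-- The index in `V` of `i`, where the natural numbers are cut into consecutive blocks indexed
by `V`. -/
noncomputable def blockPos (V : Type*) [Fintype V] [Nonempty V] (i : ℕ) : V :=
  (Fintype.equivFin V).symm ⟨i % Fintype.card V, Nat.mod_lt _ Fintype.card_pos⟩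

theorem eq_of_blockPos_eq {i j : ℕ} (h : blockPos V i = blockPos V j)
    (hb : i / Fintype.card V = j / Fintype.card V) : i = j := by
  have : i % Fintype.card V = j % Fintype.card V := by simpa [blockPos] using h
  rw [← Nat.div_add_mod i (Fintype.card V), ← Nat.div_add_mod j (Fintype.card V), this, hb]

/-- The graph on `Fin n` consisting of all pairs of different parity and, on each of the two
parity classes, of disjoint copies of `H` (the last one possibly truncated). -/
def bipartiteJoin (H : SimpleGraph V) (n : ℕ) : SimpleGraph (Fin n) where
  Adj u v := (u : ℕ) % 2 ≠ v % 2 ∨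
    (u : ℕ) / 2 / Fintype.card V = v / 2 / Fintype.card V ∧
      H.Adj (blockPos V (u / 2)) (blockPos V (v / 2))
  symm := ⟨fun u v h => h.imp Ne.symm fun h => ⟨h.1.symm, h.2.symm⟩⟩
  loopless := ⟨fun u h => by simp at h⟩

/-- An independent set lies in one parity class, and there it meets each block in an independent set
of `H`. -/
theorem bipartiteJoin_indepNum_le (H : SimpleGraph V) (n : ℕ) :
    (bipartiteJoin H n).indepNum ≤ H.indepNum * (n / 2 / Fintype.card V + 1) := by
  classical
  obtain ⟨A, hA⟩ := (bipartiteJoin H n).exists_isNIndepSet_indepNum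
  have hnadj : ∀ u ∈ A, ∀ v ∈ A, ¬ (bipartiteJoin H n).Adj u v := fun u hu v hv huv =>
    hA.isIndepSet hu hv huv.ne huv
  rw [← hA.card_eq, ← Finset.card_range (n / 2 / Fintype.card V + 1)]
  refine Finset.card_le_mul_card_image_of_maps_to
    (f := fun u : Fin n => (u : ℕ) / 2 / Fintype.card V) (fun u _ => ?_) _ fun b _ => ?_
  · rw [Finset.mem_range, Nat.lt_succ_iff]
    exact Nat.div_le_div_right (Nat.div_le_div_right u.2.le)
  · have hinj : Set.InjOn (fun u : Fin n => blockPos V ((u : ℕ) / 2))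
        ({u ∈ A | (u : ℕ) / 2 / Fintype.card V = b} : Finset (Fin n)) := by
      intro u hu v hv huv
      simp only [coe_filter, Set.mem_ofPred_eq] at hu hv
      have h2 := eq_of_blockPos_eq huv (hu.2.trans hv.2.symm)
      have h1 : (u : ℕ) % 2 = v % 2 := by
        by_contra h
        exact hnadj u hu.1 v hv.1 (Or.inl h)
      ext
      omega
    rw [← Finset.card_image_of_injOn hinj]
    refine SimpleGraph.IsIndepSet.card_le_indepNum ?_
    intro x hx y hy _ hxy
    simp only [coe_image, coe_filter, Set.mem_image, Set.mem_ofPred_eq] at hx hy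
    obtain ⟨u, ⟨hu, hub⟩, rfl⟩ := hx
    obtain ⟨v, ⟨hv, hvb⟩, rfl⟩ := hy
    exact hnadj u hu v hv (Or.inr ⟨hub.trans hvb.symm, hxy⟩)

open Classical in
/-- The coloring of `bipartiteJoin H n` that gives color `2` to the pairs of equal parity and
color `1` to the pairs of different parity that are selected by `s`. -/
noncomputable def bipartiteJoinColoring (H : SimpleGraph V) (n : ℕ)
    (s : Finset (Fin (n / 2) × Fin (n / 2))) : (bipartiteJoin H n).EdgeLabeling (Fin 3) :=
  SimpleGraph.EdgeLabeling.mk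
    (fun u v _ => if (u : ℕ) % 2 = v % 2 then 2 else
      if ∃ p ∈ s, (u : ℕ) = 2 * p.1 ∧ (v : ℕ) = 2 * p.2 + 1 ∨
        (v : ℕ) = 2 * p.1 ∧ (u : ℕ) = 2 * p.2 + 1 then 1 else 0)
    (fun u v _ => by simp only [eq_comm (a := (v : ℕ) % 2), or_comm])

open Classical in
theorem bipartiteJoinColoring_get (H : SimpleGraph V) (n : ℕ)
    (s : Finset (Fin (n / 2) × Fin (n / 2))) (u v : Fin n) (h : (bipartiteJoin H n).Adj u v) :
    (bipartiteJoinColoring H n s).get u v h = if (u : ℕ) % 2 = v % 2 then 2 else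
      if ∃ p ∈ s, (u : ℕ) = 2 * p.1 ∧ (v : ℕ) = 2 * p.2 + 1 ∨
        (v : ℕ) = 2 * p.1 ∧ (u : ℕ) = 2 * p.2 + 1 then 1 else 0 :=
  rfl

/-- Color 2 maps homomorphically to `H` by `blockPos`; colors 0 and 1 are bipartite by parity. -/
theorem bipartiteJoinColoring_labelGraph_cliqueFree {H : SimpleGraph V} (hH : H.CliqueFree 3)
    (n : ℕ) (s : Finset (Fin (n / 2) × Fin (n / 2))) (c : Fin 3) :
    ((bipartiteJoinColoring H n s).labelGraph c).CliqueFree 3 := by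
  classical
  intro t ht
  obtain ⟨x, y, z, hxy, hxz, hyz, -⟩ := SimpleGraph.is3Clique_iff.1 ht
  simp only [SimpleGraph.EdgeLabeling.labelGraph_adj, ← SimpleGraph.EdgeLabeling.get_eq,
    bipartiteJoinColoring_get] at hxy hxz hyz
  obtain ⟨axy, hxy⟩ := hxy
  obtain ⟨axz, hxz⟩ := hxz
  obtain ⟨ayz, hyz⟩ := hyz
  rcases eq_or_ne c 2 with rfl | hc
  · have key : ∀ u v : Fin n, (bipartiteJoin H n).Adj u v →
        (if (u : ℕ) % 2 = v % 2 then (2 : Fin 3) else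
          if ∃ p ∈ s, (u : ℕ) = 2 * p.1 ∧ (v : ℕ) = 2 * p.2 + 1 ∨
            (v : ℕ) = 2 * p.1 ∧ (u : ℕ) = 2 * p.2 + 1 then 1 else 0) = 2 →
        H.Adj (blockPos V (u / 2)) (blockPos V (v / 2)) := by
      intro u v huv h
      split_ifs at h with h1 h2
      · exact (huv.resolve_left (not_not.2 h1)).2
      · simp at h
      · simp at h
    exact hH _ (SimpleGraph.is3Clique_iff.2 ⟨_, _, _, key _ _ axy hxy, key _ _ axz hxz,
      key _ _ ayz hyz, rfl⟩)
  · have key : ∀ (u v : Fin n) (d : Fin 3),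
        (if (u : ℕ) % 2 = v % 2 then (2 : Fin 3) else d) = c → (u : ℕ) % 2 ≠ v % 2 := by
      intro u v d h h1
      rw [if_pos h1] at h
      exact hc h.symm
    have h1 := key _ _ _ hxy
    have h2 := key _ _ _ hxz
    have h3 := key _ _ _ hyz
    omega

theorem bipartiteJoinColoring_injective (H : SimpleGraph V) (n : ℕ) :
    Function.Injective (bipartiteJoinColoring H n) := by
  classical
  have adj : ∀ i j : Fin (n / 2), (bipartiteJoin H n).Adj
      ⟨2 * i, by omega⟩ ⟨2 * j + 1, by omega⟩ := fun i j => Or.inl (by simp)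
  have key : ∀ (s : Finset (Fin (n / 2) × Fin (n / 2))) (i j : Fin (n / 2)),
      (i, j) ∈ s ↔ (bipartiteJoinColoring H n s).get _ _ (adj i j) = 1 := by
    intro s i j
    rw [bipartiteJoinColoring_get, if_neg (by simp)]
    constructor
    · intro h
      exact if_pos ⟨(i, j), h, Or.inl ⟨rfl, rfl⟩⟩
    · intro h
      split_ifs at h with h1
      · obtain ⟨⟨a, b⟩, hp, h2⟩ := h1
        simp only at h2
        obtain rfl : a = i := by ext; omega
        obtain rfl : b = j := by ext; omega
        exact hp
      · simp at h
  intro s t hst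
  ext ⟨i, j⟩
  rw [key, key, hst]

theorem two_pow_le_numMonoCliqueFreeColorings {H : SimpleGraph V} (hH : H.CliqueFree 3) (n : ℕ) :
    2 ^ (n / 2) ^ 2 ≤ numMonoCliqueFreeColorings 3 3 (bipartiteJoin H n) := by
  have h : Nat.card (Finset (Fin (n / 2) × Fin (n / 2))) = 2 ^ (n / 2) ^ 2 := by
    simp [Nat.card_eq_fintype_card, sq]
  rw [← h]
  exact Nat.card_le_card_of_injective
    (fun s => ⟨bipartiteJoinColoring H n s, bipartiteJoinColoring_labelGraph_cliqueFree hH n s⟩)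
    fun s t hst => bipartiteJoinColoring_injective H n (congrArg Subtype.val hst)

end Construction

/-- For large `n`, some `n`-vertex graph of independence number at most `ε n` has at least
`2 ^ ⌊n / 2⌋ ^ 2` three-edge-colorings without a monochromatic triangle. -/
theorem exists_indepNum_le_two_pow_le {ε : ℝ} (hε : 0 < ε) :
    ∃ n₀ : ℕ, ∀ n : ℕ, n₀ ≤ n → ∃ G : SimpleGraph (Fin n), (G.indepNum : ℝ) ≤ ε * n ∧
      2 ^ (n / 2) ^ 2 ≤ numMonoCliqueFreeColorings 3 3 G := by
  obtain ⟨k, hk⟩ := exists_cliqueFree_three_indepNum_le (half_pos hε)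
  refine ⟨Fintype.card (Fin (3 * k) → Bool), fun n hn =>
    ⟨bipartiteJoin (farCubeGraph k) n, ?_,
      two_pow_le_numMonoCliqueFreeColorings (farCubeGraph_cliqueFree k) n⟩⟩
  set m := Fintype.card (Fin (3 * k) → Bool) with hm
  have hm0 : 0 < m := Fintype.card_pos
  -- The truncated last block costs at most m ≤ n, which is why ε was halved.
  have h1 : m * (n / 2 / m + 1) ≤ 2 * n := by
    have := Nat.mul_div_le (n / 2) m
    rw [mul_add, mul_one]
    omega
  have h2 : (m : ℝ) * ((n / 2 / m : ℕ) + 1) ≤ 2 * n := by exact_mod_cast h1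
  calc ((bipartiteJoin (farCubeGraph k) n).indepNum : ℝ)
      ≤ (farCubeGraph k).indepNum * ((n / 2 / m : ℕ) + 1) := by
        exact_mod_cast bipartiteJoin_indepNum_le (farCubeGraph k) n
    _ ≤ ε / 2 * m * ((n / 2 / m : ℕ) + 1) := by gcongr
    _ ≤ ε / 2 * (2 * n) := by
        rw [mul_assoc]
        gcongr
    _ = ε * n := by ring

/-! ### Counting small sets and triangle-free graphs. -/

/-- The number of subsets of at most a `γ` proportion of a finite type is subexponential. -/
theorem exists_card_finset_card_le {δ : ℝ} (hδ : 0 < δ) :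
    ∃ γ : ℝ, 0 < γ ∧ ∀ (α : Type) [Fintype α],
      (Nat.card {s : Finset α // (#s : ℝ) ≤ γ * Fintype.card α} : ℝ) ≤
        2 ^ (δ * Fintype.card α) := by
  set z : ℝ := 2 ^ (δ / 2) with hz
  have hz1 : 1 < z := Real.one_lt_rpow one_lt_two (half_pos hδ)
  -- Exponential weights: small sets have weight y^(γN - |s|) ≥ 1, and the total weight is y^(γN) (1
  -- + 1/y)^N. With this y and y^γ = z, each factor is at most z^N.
  set y : ℝ := z / (z - 1) with hy
  have hy1 : 1 < y := by rw [hy, one_lt_div (by linarith)]; linarith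
  have hyz : 1 + y⁻¹ ≤ z := by
    have h1 : (z - 1) / z ≤ z - 1 := div_le_self (by linarith) hz1.le
    rw [hy, inv_div]
    linarith
  have hlog : 0 < Real.logb 2 y := Real.logb_pos one_lt_two hy1
  refine ⟨δ / 2 / Real.logb 2 y, by positivity, fun α _ => ?_⟩
  classical
  set γ : ℝ := δ / 2 / Real.logb 2 y with hγ
  set N := Fintype.card α with hN
  have hyγ : y ^ (γ * N) = z ^ N := by
    rw [Real.rpow_mul (by linarith), Real.rpow_natCast, hz]
    congr 1
    conv_lhs => rw [← Real.rpow_logb (b := 2) (x := y) two_pos (by norm_num) (by linarith)]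
    rw [← Real.rpow_mul two_pos.le, hγ, mul_div_cancel₀ _ hlog.ne']
  rw [Nat.card_eq_fintype_card, Fintype.card_subtype]
  calc ((#{s : Finset α | (#s : ℝ) ≤ γ * N} : ℕ) : ℝ)
      = ∑ s : Finset α with (#s : ℝ) ≤ γ * N, (1 : ℝ) := by simp
    _ ≤ ∑ s : Finset α with (#s : ℝ) ≤ γ * N, y ^ (γ * N) * y⁻¹ ^ #s := by
        refine Finset.sum_le_sum fun s hs => ?_
        have hs := (Finset.mem_filter.1 hs).2
        rw [inv_pow, ← Real.rpow_natCast, ← div_eq_mul_inv, one_le_div (by positivity)]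
        exact Real.rpow_le_rpow_of_exponent_le hy1.le hs
    _ ≤ ∑ s : Finset α, y ^ (γ * N) * y⁻¹ ^ #s := by
        refine Finset.sum_le_sum_of_subset_of_nonneg (Finset.filter_subset _ _) fun s _ _ => ?_
        positivity
    _ = z ^ N * (1 + y⁻¹) ^ N := by
        have := Fintype.sum_pow_mul_eq_add_pow α y⁻¹ 1
        simp only [one_pow, mul_one] at this
        rw [← Finset.mul_sum, this, hyγ, add_comm]
    _ ≤ z ^ N * z ^ N := by gcongr
    _ = 2 ^ (δ * N) := by
        rw [← mul_pow, hz, ← Real.rpow_add two_pos, add_halves, Real.rpow_mul two_pos.le,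
          Real.rpow_natCast]

/-- The number of labelled triangle-free graphs on `n` vertices. -/
noncomputable def numTriangleFree (n : ℕ) : ℕ :=
  Nat.card {H : SimpleGraph (Fin n) // H.CliqueFree 3}

/-- The graph is recovered from a vertex, its neighborhood and the graph on the other vertices. -/
theorem card_cliqueFree_degree_le (n : ℕ) (x : ℝ) :
    Nat.card {H : SimpleGraph (Fin (n + 1)) // H.CliqueFree 3 ∧
        ∃ (v : Fin (n + 1)) (s : Finset (Fin (n + 1))), (#s : ℝ) ≤ x ∧ ∀ u, H.Adj v u ↔ u ∈ s} ≤
      (n + 1) * Nat.card {s : Finset (Fin (n + 1)) // (#s : ℝ) ≤ x} * numTriangleFree n := by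
  have hcard : Nat.card (Fin (n + 1) × {s : Finset (Fin (n + 1)) // (#s : ℝ) ≤ x} ×
      {H : SimpleGraph (Fin n) // H.CliqueFree 3}) =
      (n + 1) * Nat.card {s : Finset (Fin (n + 1)) // (#s : ℝ) ≤ x} * numTriangleFree n := by
    rw [Nat.card_prod, Nat.card_prod, Nat.card_fin, mul_assoc, numTriangleFree]
  rw [← hcard]
  choose v s hs hadj using fun H : {H : SimpleGraph (Fin (n + 1)) // H.CliqueFree 3 ∧
    ∃ (v : Fin (n + 1)) (s : Finset (Fin (n + 1))), (#s : ℝ) ≤ x ∧ ∀ u, H.Adj v u ↔ u ∈ s} =>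
      H.2.2
  refine Nat.card_le_card_of_injective (fun H => (v H, ⟨s H, hs H⟩,
    ⟨H.1.comap (v H).succAboveEmb,
      H.2.1.comap ⟨(SimpleGraph.Embedding.comap _ _).toCopy⟩⟩)) fun H K hHK => ?_
  simp only [Prod.mk.injEq, Subtype.mk.injEq] at hHK
  obtain ⟨hv, hs', hc⟩ := hHK
  have h1 : ∀ u, H.1.Adj (v H) u ↔ K.1.Adj (v H) u := fun u => by
    rw [hadj, hs', ← hadj, hv]
  ext a b
  rcases eq_or_ne a (v H) with rfl | ha
  · exact h1 b
  rcases eq_or_ne b (v H) with rfl | hb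
  · rw [H.1.adj_comm, h1, K.1.adj_comm]
  obtain ⟨a, rfl⟩ := Fin.exists_succAbove_eq ha
  obtain ⟨b, rfl⟩ := Fin.exists_succAbove_eq hb
  have := congrArg (fun L : SimpleGraph (Fin n) => L.Adj a b) hc
  rw [← hv] at this
  simpa using this

/-- In a triangle-free graph every vertex sees only one side of a complete bipartite subgraph. -/
theorem exists_neighbors_of_cliqueFree {V : Type*} {t : ℕ} {H : SimpleGraph V}
    (hH : H.CliqueFree 3) (f : Fin 2 × Fin t → V)
    (hf : ∀ i j, H.Adj (f (0, i)) (f (1, j))) (v : V) :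
    ∃ p : Fin 2 × Finset (Fin t), ∀ i j, H.Adj v (f (i, j)) ↔ i = p.1 ∧ j ∈ p.2 := by
  classical
  by_cases h : ∃ j, H.Adj v (f (0, j))
  · obtain ⟨k, hk⟩ := h
    refine ⟨(0, univ.filter fun j => H.Adj v (f (0, j))), fun i j => ?_⟩
    rcases Fin.exists_fin_two.1 ⟨i, rfl⟩ with rfl | rfl
    · simp
    · simp only [one_ne_zero, false_and, iff_false]
      exact fun h => hH _ (SimpleGraph.is3Clique_iff.2 ⟨_, _, _, hk, h, hf k j, rfl⟩)
  · refine ⟨(1, univ.filter fun j => H.Adj v (f (1, j))), fun i j => ?_⟩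
    rcases Fin.exists_fin_two.1 ⟨i, rfl⟩ with rfl | rfl
    · simpa using fun hj => h ⟨j, hj⟩
    · simp

theorem exists_embedding_forall_notMem_range {α : Type*} [Fintype α] (m t : ℕ)
    (f : α → Fin (m + t)) (hf : Function.Injective f) (hα : Fintype.card α = t) :
    ∃ g : Fin m ↪ Fin (m + t), ∀ v, v ∉ Set.range f → v ∈ Set.range g := by
  classical
  have hcard : #((univ.image f)ᶜ) = m := by
    rw [Finset.card_compl, Finset.card_image_of_injective _ hf, Finset.card_univ, hα]
    simp
  refine ⟨((univ.image f)ᶜ.orderEmbOfFin hcard).toEmbedding, fun v hv => ?_⟩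
  change v ∈ Set.range ((univ.image f)ᶜ.orderEmbOfFin hcard)
  rw [Finset.range_orderEmbOfFin]
  simpa using hv

/-- Each vertex sees one side of the K_{t,t} only, so its trace has 2·2^t possibilities instead of
4^t. This saving produces the constant 1/4. -/
theorem card_cliqueFree_isContained_le (m t : ℕ) :
    Nat.card {H : SimpleGraph (Fin (m + 2 * t)) // H.CliqueFree 3 ∧
        (SimpleGraph.completeEquipartiteGraph 2 t).IsContained H} ≤
      (m + 2 * t) ^ (2 * t) * (2 * 2 ^ t) ^ (m + 2 * t) * numTriangleFree m := by
  have hcard : Nat.card ((Fin 2 × Fin t → Fin (m + 2 * t)) ×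
      (Fin (m + 2 * t) → Fin 2 × Finset (Fin t)) × {H : SimpleGraph (Fin m) // H.CliqueFree 3}) =
      (m + 2 * t) ^ (2 * t) * (2 * 2 ^ t) ^ (m + 2 * t) * numTriangleFree m := by
    simp [Nat.card_prod, numTriangleFree, mul_assoc]
  rw [← hcard]
  have hcopy : ∀ H : {H : SimpleGraph (Fin (m + 2 * t)) // H.CliqueFree 3 ∧
      (SimpleGraph.completeEquipartiteGraph 2 t).IsContained H},
      ∃ f : Fin 2 × Fin t → Fin (m + 2 * t), Function.Injective f ∧
        ∀ i j, H.1.Adj (f (0, i)) (f (1, j)) := fun H => by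
    obtain ⟨φ⟩ := H.2.2
    exact ⟨φ, φ.injective, fun i j => φ.toHom.map_adj
      (by simp)⟩
  choose f hf hadj using hcopy
  choose p hp using fun H => exists_neighbors_of_cliqueFree H.2.1 (f H) (hadj H)
  have : Nonempty (Fin m ↪ Fin (m + 2 * t)) := ⟨Fin.castAddEmb _⟩
  -- The embedding `g` depends on `f` alone, so graphs with equal codes are compared along the same
  -- embedding.
  choose! g hg using fun f : Fin 2 × Fin t → Fin (m + 2 * t) => fun hf : Function.Injective f =>
    exists_embedding_forall_notMem_range m (2 * t) f hf (by simp)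
  refine Nat.card_le_card_of_injective (fun H => (f H, p H,
    ⟨H.1.comap (g (f H)), H.2.1.comap ⟨(SimpleGraph.Embedding.comap _ _).toCopy⟩⟩)) fun H K hHK => ?_
  simp only [Prod.mk.injEq, Subtype.mk.injEq] at hHK
  obtain ⟨hfe, hpe, hc⟩ := hHK
  have h1 : ∀ v x, H.1.Adj v (f H x) ↔ K.1.Adj v (f H x) := by
    rintro v ⟨i, j⟩
    rw [hp, hpe, ← hp, hfe]
  ext a b
  by_cases hb : b ∈ Set.range (f H)
  · obtain ⟨x, rfl⟩ := hb
    exact h1 a x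
  by_cases ha : a ∈ Set.range (f H)
  · obtain ⟨x, rfl⟩ := ha
    rw [H.1.adj_comm, h1, K.1.adj_comm]
  obtain ⟨a, rfl⟩ := hg _ (hf H) a ha
  obtain ⟨b, rfl⟩ := hg _ (hf H) b hb
  have := congrArg (fun L : SimpleGraph (Fin m) => L.Adj a b) hc
  rw [← hfe] at this
  simpa using this

/-- The recursive bound on the number of triangle-free graphs: remove a vertex of small degree, or
a copy of `K_{t,t}`. -/
theorem exists_numTriangleFree_le (t : ℕ) :
    ∃ n₀ : ℕ, ∀ n : ℕ, n₀ ≤ n → (numTriangleFree n : ℝ) ≤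
      n * 2 ^ ((1 / 8 : ℝ) * n) * numTriangleFree (n - 1) +
        (n : ℝ) ^ (2 * t) * (2 * 2 ^ t) ^ n * numTriangleFree (n - 2 * t) := by
  classical
  obtain ⟨γ, hγ, hsmall⟩ := exists_card_finset_card_le (show (0 : ℝ) < 1 / 8 by norm_num)
  -- Minimum-degree Erdős–Stone for two parts: any positive proportion γ forces K_{t,t}.
  obtain ⟨n₁, hn₁⟩ := Filter.eventually_atTop.1
    (SimpleGraph.eventually_completeEquipartiteGraph_isContained_of_minDegree hγ 1 t)
  refine ⟨n₁ + 2 * t + 1, fun n hn => ?_⟩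
  have h1 : (Nat.card {H : SimpleGraph (Fin n) // H.CliqueFree 3 ∧
      ∃ (v : Fin n) (s : Finset (Fin n)), (#s : ℝ) ≤ γ * n ∧ ∀ u, H.Adj v u ↔ u ∈ s} : ℝ) ≤
      n * 2 ^ ((1 / 8 : ℝ) * n) * numTriangleFree (n - 1) := by
    obtain ⟨m, rfl⟩ : ∃ m, n = m + 1 := ⟨n - 1, by omega⟩
    have h := hsmall (Fin (m + 1))
    rw [Fintype.card_fin] at h
    calc _ ≤ (((m + 1) * Nat.card {s : Finset (Fin (m + 1)) // (#s : ℝ) ≤ γ * ((m + 1 : ℕ) : ℝ)} *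
          numTriangleFree m : ℕ) : ℝ) := by
          exact_mod_cast card_cliqueFree_degree_le m (γ * ((m + 1 : ℕ) : ℝ))
      _ ≤ _ := by
          rw [Nat.cast_mul, Nat.cast_mul, Nat.add_sub_cancel]
          gcongr
  have h2 : (Nat.card {H : SimpleGraph (Fin n) // H.CliqueFree 3 ∧
      (SimpleGraph.completeEquipartiteGraph 2 t).IsContained H} : ℝ) ≤
      (n : ℝ) ^ (2 * t) * (2 * 2 ^ t) ^ n * numTriangleFree (n - 2 * t) := by
    obtain ⟨m, rfl⟩ : ∃ m, n = m + 2 * t := ⟨n - 2 * t, by omega⟩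
    rw [Nat.add_sub_cancel]
    exact_mod_cast card_cliqueFree_isContained_le m t
  refine le_trans ?_ (add_le_add h1 h2)
  rw [numTriangleFree]
  simp only [Nat.card_eq_fintype_card, Fintype.card_subtype]
  norm_cast
  refine (Finset.card_le_card fun H hH => ?_).trans (Finset.card_union_le _ _)
  simp only [mem_filter_univ, mem_union] at hH ⊢
  by_cases hdeg : γ * n ≤ H.minDegree
  · refine Or.inr ⟨hH, ?_⟩
    refine hn₁ n (by omega) (G := H) ?_
    simpa using hdeg
  · have : Nonempty (Fin n) := ⟨⟨0, by omega⟩⟩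
    obtain ⟨v, hv⟩ := H.exists_minimal_degree_vertex
    refine Or.inl ⟨hH, v, H.neighborFinset v, ?_, fun u => by simp⟩
    rw [SimpleGraph.card_neighborFinset_eq_degree, ← hv]
    exact (not_le.1 hdeg).le

/-- Erdős–Kleitman–Rothschild: there are `2 ^ (n ^ 2 / 4 + o(n ^ 2))` triangle-free graphs on `n`
vertices; upper bound. -/
theorem exists_numTriangleFree_le_two_rpow {β : ℝ} (hβ : 0 < β) :
    ∃ D : ℝ, ∀ n : ℕ, (numTriangleFree n : ℝ) ≤ 2 ^ ((1 / 4 + β) * (n : ℝ) ^ 2 + D) := by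
  -- Removing K_{t,t} costs an exponent of at most (t + 2)n, while the main term drops by tn + 4βtn
  -- up to a constant; βt ≥ 1 absorbs the excess 2n.
  obtain ⟨t, ht⟩ := exists_nat_ge (1 / β)
  have htβ : 1 ≤ β * t := by
    rw [div_le_iff₀ hβ] at ht
    linarith
  have ht1 : 1 ≤ t := by
    by_contra h
    obtain rfl : t = 0 := by omega
    norm_num at htβ
  obtain ⟨n₁, hn₁⟩ := exists_numTriangleFree_le t
  have hpoly : ∀ k : ℕ, ∀ r : ℝ, 0 < r → ∀ᶠ n : ℕ in Filter.atTop,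
      (n : ℝ) ^ k ≤ 2 ^ (r * n) := fun k r hr => by
    have h2 : 1 < (2 : ℝ) ^ r := Real.one_lt_rpow one_lt_two hr
    filter_upwards [(isLittleO_pow_const_const_pow_of_one_lt (R := ℝ) k h2).bound one_pos]
      with n hn
    rw [Real.rpow_mul two_pos.le, Real.rpow_natCast]
    simpa [abs_of_pos (Real.rpow_pos_of_pos two_pos r)] using hn
  obtain ⟨n₂, hn₂⟩ := Filter.eventually_atTop.1
    ((hpoly 1 (1 / 8) (by norm_num)).and (hpoly (2 * t) 1 one_pos))
  obtain ⟨n₃, hn₃⟩ := exists_nat_ge (1 + 4 * (1 / 4 + β) * (t : ℝ) ^ 2)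
  -- The 5 serves vertex removal: n/4 + (n - 1)²/4 ≤ n²/4 - 1 exactly when n ≥ 5. The -1 in both
  -- exponents lets the two terms add up.
  set n₀ := n₁ + n₂ + n₃ + 2 * t + 5 with hn₀
  refine ⟨(∑ k ∈ range n₀, numTriangleFree k : ℕ), fun n => ?_⟩
  set D : ℝ := ((∑ k ∈ range n₀, numTriangleFree k : ℕ) : ℝ) with hD
  induction n using Nat.strong_induction_on with
  | _ n ih =>
  rcases lt_or_ge n n₀ with hn | hn
  · calc (numTriangleFree n : ℝ) ≤ ((∑ k ∈ range n₀, numTriangleFree k : ℕ) : ℝ) := by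
          exact_mod_cast Finset.single_le_sum (f := numTriangleFree)
            (fun _ _ => Nat.zero_le _) (Finset.mem_range.2 hn)
      _ ≤ 2 ^ (∑ k ∈ range n₀, numTriangleFree k) := by
          exact_mod_cast Nat.lt_two_pow_self.le
      _ = 2 ^ D := by rw [hD, Real.rpow_natCast]
      _ ≤ _ := Real.rpow_le_rpow_of_exponent_le one_le_two (by
          have : 0 ≤ (1 / 4 + β) * (n : ℝ) ^ 2 := by positivity
          linarith)
  · obtain ⟨hp1, hp2⟩ := hn₂ n (by omega)
    rw [pow_one] at hp1
    have hnR : (5 : ℝ) ≤ n := by exact_mod_cast (by omega : 5 ≤ n)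
    have hn3 : 1 + 4 * (1 / 4 + β) * (t : ℝ) ^ 2 ≤ n :=
      hn₃.trans (by exact_mod_cast (by omega : n₃ ≤ n))
    set c : ℝ := 1 / 4 + β with hc
    have e1 : (n : ℝ) * 2 ^ ((1 / 8 : ℝ) * n) * numTriangleFree (n - 1) ≤
        2 ^ (c * (n : ℝ) ^ 2 + D - 1) := by
      have h := ih (n - 1) (by omega)
      rw [Nat.cast_sub (by omega), Nat.cast_one] at h
      calc _ ≤ (2 : ℝ) ^ ((1 / 8 : ℝ) * n) * 2 ^ ((1 / 8 : ℝ) * n) *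
            2 ^ (c * ((n : ℝ) - 1) ^ 2 + D) := by gcongr
        _ = 2 ^ ((1 / 8 : ℝ) * n + (1 / 8 : ℝ) * n + (c * ((n : ℝ) - 1) ^ 2 + D)) := by
            rw [← Real.rpow_add two_pos, ← Real.rpow_add two_pos]
        _ ≤ _ := Real.rpow_le_rpow_of_exponent_le one_le_two (by
            have : 0 ≤ β * (2 * n - 1) := mul_nonneg hβ.le (by linarith)
            rw [hc]
            linarith)
    have e2 : (n : ℝ) ^ (2 * t) * (2 * 2 ^ t) ^ n * numTriangleFree (n - 2 * t) ≤
        2 ^ (c * (n : ℝ) ^ 2 + D - 1) := by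
      have h := ih (n - 2 * t) (by omega)
      rw [Nat.cast_sub (by omega)] at h
      push_cast at h
      have h2 : ((2 : ℝ) * 2 ^ t) ^ n = 2 ^ (((t : ℝ) + 1) * n) := by
        rw [Real.rpow_mul two_pos.le, Real.rpow_natCast, Real.rpow_add two_pos, Real.rpow_natCast,
          Real.rpow_one, mul_comm]
      calc _ ≤ (2 : ℝ) ^ (1 * (n : ℝ)) * 2 ^ (((t : ℝ) + 1) * n) *
            2 ^ (c * ((n : ℝ) - 2 * t) ^ 2 + D) := by
              rw [h2]
              gcongr
        _ = 2 ^ (1 * (n : ℝ) + ((t : ℝ) + 1) * n + (c * ((n : ℝ) - 2 * t) ^ 2 + D)) := by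
            rw [← Real.rpow_add two_pos, ← Real.rpow_add two_pos]
        _ ≤ _ := Real.rpow_le_rpow_of_exponent_le one_le_two (by
            have : 0 ≤ (β * t - 1) * n := mul_nonneg (by linarith) (by linarith)
            have h3 : c * ((n : ℝ) - 2 * t) ^ 2 =
                c * (n : ℝ) ^ 2 - t * n - 4 * (β * t) * n + 4 * c * (t : ℝ) ^ 2 := by
              rw [hc]
              ring
            rw [h3]
            linarith)
    calc (numTriangleFree n : ℝ) ≤ _ := hn₁ n (by omega)
      _ ≤ 2 ^ (c * (n : ℝ) ^ 2 + D - 1) + 2 ^ (c * (n : ℝ) ^ 2 + D - 1) := add_le_add e1 e2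
      _ = _ := by
          rw [Real.rpow_sub_one two_ne_zero]
          ring

/-! ### Assigning colors to vertices. -/

/-- Greedy covering: few neighborhoods cover a large part of every neighborhood. -/
theorem exists_cover_neighbors {V : Type*} [Fintype V] [DecidableEq V] (H : SimpleGraph V)
    [DecidableRel H.Adj] (x : ℝ) (hx : 0 ≤ x) :
    ∃ T : Finset V, (#T : ℝ) * x ≤ Fintype.card V ∧
      ∀ v, (#{u | H.Adj v u ∧ ∀ t ∈ T, ¬ H.Adj t u} : ℝ) ≤ x := by
  let cov : Finset V → Finset V := fun T => {u | ∃ t ∈ T, H.Adj t u}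
  -- Take a largest `T` whose members cover at least x vertices each on average; a vertex with more
  -- than x uncovered neighbors could be added.
  obtain ⟨T, hT, hmax⟩ := Finset.exists_max_image
    (univ.filter fun T : Finset V => (#T : ℝ) * x ≤ #(cov T)) card ⟨∅, by simp⟩
  rw [mem_filter_univ] at hT
  refine ⟨T, hT.trans (by exact_mod_cast Finset.card_le_univ _), fun v => ?_⟩
  by_contra! hv
  have hvT : v ∉ T := fun hvT => by
    rw [Finset.filter_false_of_mem fun u _ h => h.2 v hvT h.1] at hv
    simp at hv
    linarith
  have hdisj : Disjoint (cov T) (univ.filter fun u => H.Adj v u ∧ ∀ t ∈ T, ¬ H.Adj t u) := by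
    rw [Finset.disjoint_left]
    intro u hu hu'
    simp only [cov, mem_filter_univ] at hu hu'
    obtain ⟨t, ht, htu⟩ := hu
    exact hu'.2 t ht htu
  have hsub : cov T ∪ (univ.filter fun u => H.Adj v u ∧ ∀ t ∈ T, ¬ H.Adj t u) ⊆
      cov (insert v T) := by
    intro u hu
    simp only [cov, mem_union, mem_filter_univ, mem_insert, exists_eq_or_imp] at hu ⊢
    exact hu.symm.imp And.left id
  have hcard := Finset.card_le_card hsub
  rw [Finset.card_union_of_disjoint hdisj] at hcard
  have hcard' : (#(cov T) : ℝ) + #{u | H.Adj v u ∧ ∀ t ∈ T, ¬ H.Adj t u} ≤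
      #(cov (insert v T)) := by exact_mod_cast hcard
  have := hmax (insert v T) (by
    rw [mem_filter_univ, Finset.card_insert_of_notMem hvT]
    push_cast
    linarith)
  rw [Finset.card_insert_of_notMem hvT] at this
  omega

/-- In a three-edge-coloring without monochromatic triangles of a graph with small independence
number, almost every vertex `u` can be assigned a color `c` such that every vertex has few
neighbors of color `c` among the vertices assigned `c`. -/
theorem exists_color_assignment {V : Type*} [Fintype V] [DecidableEq V] {G : SimpleGraph V}
    (C : G.EdgeLabeling (Fin 3)) (hC : ∀ c, (C.labelGraph c).CliqueFree 3) {γ : ℝ} (hγ : 0 < γ)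
    (hG : (G.indepNum : ℝ) ≤ γ ^ 4 * Fintype.card V) :
    ∃ p : V → Option (Fin 3), (#{u | p u = none} : ℝ) ≤ γ * Fintype.card V ∧
      ∀ c v, (Nat.card {u // (C.labelGraph c).Adj v u ∧ p u = some c} : ℝ) ≤
        γ * Fintype.card V := by
  classical
  rcases isEmpty_or_nonempty V with hV | hV
  · exact ⟨fun _ => none, by simp, fun c v => isEmptyElim v⟩
  set n : ℝ := (Fintype.card V : ℝ) with hn
  have hn0 : 0 < n := Nat.cast_pos.2 Fintype.card_pos
  choose T hT hcov using fun c => exists_cover_neighbors (C.labelGraph c) (γ * n) (by positivity)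
  have hTγ : ∀ c, (#(T c) : ℝ) ≤ γ⁻¹ := fun c => by
    rw [← one_div, le_div_iff₀ hγ]
    refine le_of_mul_le_mul_right ?_ hn0
    linarith [hT c]
  let unc : V → Fin 3 → Prop := fun u c => ∀ t ∈ T c, ¬ (C.labelGraph c).Adj t u
  let p : V → Option (Fin 3) := fun u => if h : ∃ c, unc u c then some h.choose else none
  have hp : ∀ u c, p u = some c → unc u c := fun u c h => by
    by_cases hu : ∃ c, unc u c
    · simp only [p, dif_pos hu, Option.some.injEq] at h
      exact h ▸ hu.choose_spec
    · simp [p, dif_neg hu] at h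
  refine ⟨p, ?_, fun c v => ?_⟩
  -- An unassigned vertex is covered in every color, so it lies in the cell of some triple τ. There
  -- are at most γ⁻³ cells, each independent; hence the γ⁴ in the hypothesis.
  · have hsub : (univ.filter fun u => p u = none) ⊆ (Fintype.piFinset T).biUnion
        fun τ => univ.filter fun u => ∀ c, (C.labelGraph c).Adj (τ c) u := by
      intro u hu
      have hu : ∀ c, ∃ t ∈ T c, (C.labelGraph c).Adj t u := by
        by_contra! h
        obtain ⟨c, hc⟩ := h
        simp only [p, mem_filter_univ, dite_eq_right_iff, reduceCtorEq, imp_false, not_exists] at hu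
        exact hu c hc
      choose τ hτ hadj using hu
      simp only [mem_biUnion, Fintype.mem_piFinset, mem_filter_univ]
      exact ⟨τ, hτ, hadj⟩
    have hcell : ∀ τ ∈ Fintype.piFinset T,
        #(univ.filter fun u => ∀ c, (C.labelGraph c).Adj (τ c) u) ≤ G.indepNum := by
      intro τ _
      refine SimpleGraph.IsIndepSet.card_le_indepNum fun a ha b hb _ hab => ?_
      simp only [coe_filter, Set.mem_ofPred_eq, mem_univ, true_and] at ha hb
      exact hC (C ⟨s(a, b), hab⟩) _ (SimpleGraph.is3Clique_iff.2 ⟨_, _, _, ha _, hb _,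
        (SimpleGraph.EdgeLabeling.labelGraph_adj a b).2 ⟨hab, rfl⟩, rfl⟩)
    have h := (Finset.card_le_card hsub).trans (Finset.card_biUnion_le_card_mul _ _ _ hcell)
    rw [Fintype.card_piFinset, Fin.prod_univ_three] at h
    calc (#{u | p u = none} : ℝ) ≤ #(T 0) * #(T 1) * #(T 2) * G.indepNum := by exact_mod_cast h
      _ ≤ γ⁻¹ * γ⁻¹ * γ⁻¹ * (γ ^ 4 * n) := by
          gcongr <;> exact hTγ _
      _ = γ * n := by field_simp
  · refine le_trans ?_ (hcov c v)
    rw [Nat.card_eq_fintype_card, Fintype.card_subtype]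
    norm_cast
    exact Finset.card_le_card fun u hu => by
      simp only [mem_filter_univ] at hu ⊢
      exact ⟨hu.1, hp u c hu.2⟩

theorem card_le_of_card_fiber_le {V : Type*} [Fintype V] [DecidableEq V] (S : Finset (V × V))
    (x : ℝ) (h : ∀ u, (#{v | (u, v) ∈ S} : ℝ) ≤ x) : (#S : ℝ) ≤ Fintype.card V * x := by
  rw [Finset.card_eq_sum_card_fiberwise (f := Prod.fst) (t := univ) (fun _ _ => by simp)]
  push_cast
  rw [← nsmul_eq_mul, ← Finset.card_univ]
  refine Finset.sum_le_card_nsmul _ _ _ fun u _ => le_trans ?_ (h u)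
  norm_cast
  refine Finset.card_le_card_of_injOn Prod.snd ?_ ?_
  · rintro ⟨a, b⟩ hab
    simp only [coe_filter, Set.mem_ofPred_eq] at hab
    obtain ⟨hab, rfl⟩ := hab
    simpa using hab
  · rintro ⟨a, b⟩ hab ⟨a', b'⟩ hab' hb
    simp only [coe_filter, Set.mem_ofPred_eq] at hab hab'
    exact Prod.ext (hab.2.trans hab'.2.symm) hb

/-! ### Encoding a coloring. -/

open Classical in
/-- The (ordered) edges of `H` having an end that is unassigned or is assigned the color `c`. -/
noncomputable def exceptionalPairs {V : Type*} [Fintype V] (H : SimpleGraph V)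
    (p : V → Option (Fin 3)) (c : Fin 3) : Finset (V × V) :=
  {e | H.Adj e.1 e.2 ∧ (p e.1 = none ∨ p e.1 = some c ∨ p e.2 = none ∨ p e.2 = some c)}

/-- Each vertex has at most 2x partners that are unassigned or of class c; the reversed pairs double
the count. -/
theorem card_exceptionalPairs_le {V : Type*} [Fintype V] (H : SimpleGraph V)
    (p : V → Option (Fin 3)) (c : Fin 3) {x : ℝ} (h₁ : (#{u | p u = none} : ℝ) ≤ x)
    (h₂ : ∀ v, (Nat.card {u // H.Adj v u ∧ p u = some c} : ℝ) ≤ x) :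
    (#(exceptionalPairs H p c) : ℝ) ≤ 4 * (Fintype.card V * x) := by
  classical
  let E : Finset (V × V) := {e | H.Adj e.1 e.2 ∧ (p e.2 = none ∨ p e.2 = some c)}
  have hE : (#E : ℝ) ≤ Fintype.card V * (x + x) := by
    refine card_le_of_card_fiber_le E _ fun u => le_trans ?_ (add_le_add h₁ (h₂ u))
    rw [Nat.card_eq_fintype_card, Fintype.card_subtype]
    norm_cast
    refine (Finset.card_le_card fun v hv => ?_).trans (Finset.card_union_le _ _)
    simp only [E, mem_filter_univ, mem_union] at hv ⊢
    exact hv.2.imp id fun h => ⟨hv.1, h⟩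
  have hsub : exceptionalPairs H p c ⊆ E ∪ E.image Prod.swap := by
    rintro ⟨a, b⟩ hab
    simp only [exceptionalPairs, mem_filter_univ] at hab
    simp only [mem_union, mem_image, Prod.exists, E, mem_filter_univ]
    rcases hab with ⟨hab, h | h | h | h⟩
    · exact Or.inr ⟨b, a, ⟨hab.symm, Or.inl h⟩, rfl⟩
    · exact Or.inr ⟨b, a, ⟨hab.symm, Or.inr h⟩, rfl⟩
    · exact Or.inl ⟨hab, Or.inl h⟩
    · exact Or.inl ⟨hab, Or.inr h⟩
  have h := (Finset.card_le_card hsub).trans (Finset.card_union_le _ _)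
  have h' : (#(exceptionalPairs H p c) : ℝ) ≤ #E + #(E.image Prod.swap) := by exact_mod_cast h
  have h3 : (#(E.image Prod.swap) : ℝ) ≤ #E := by exact_mod_cast Finset.card_image_le
  linarith

/-- The edges inside the classes of `p` whose color is the cyclic successor of the color assigned
to the class. -/
def successorGraph {V : Type*} {G : SimpleGraph V} (C : G.EdgeLabeling (Fin 3))
    (p : V → Option (Fin 3)) : SimpleGraph V where
  Adj u v := ∃ c, p u = some c ∧ p v = some c ∧ (C.labelGraph (c + 1)).Adj u v
  symm := ⟨fun _ _ ⟨c, hu, hv, h⟩ => ⟨c, hv, hu, h.symm⟩⟩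
  loopless := ⟨fun _ ⟨_, _, _, h⟩ => h.ne rfl⟩

/-- Adjacent vertices share their class, so a triangle would lie in one class c and be monochromatic
of color c+1. -/
theorem successorGraph_cliqueFree {V : Type*} {G : SimpleGraph V} {C : G.EdgeLabeling (Fin 3)}
    (hC : ∀ c, (C.labelGraph c).CliqueFree 3) (p : V → Option (Fin 3)) :
    (successorGraph C p).CliqueFree 3 := by
  classical
  intro s hs
  obtain ⟨x, y, z, ⟨c, hx, hy, hxy⟩, ⟨d, hx', -, hxz⟩, ⟨e, hy', -, hyz⟩, -⟩ :=
    SimpleGraph.is3Clique_iff.1 hs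
  obtain rfl : c = d := Option.some_injective _ (hx.symm.trans hx')
  obtain rfl : c = e := Option.some_injective _ (hy.symm.trans hy')
  exact hC _ _ (SimpleGraph.is3Clique_iff.2 ⟨_, _, _, hxy, hxz, hyz, rfl⟩)

/-- A coloring is determined by its exceptional pairs and its successor graph with respect to any
assignment of colors to vertices. -/
theorem edgeLabeling_eq_of_exceptionalPairs_eq {V : Type*} [Fintype V] {G : SimpleGraph V}
    {C C' : G.EdgeLabeling (Fin 3)} (p : V → Option (Fin 3))
    (hX : ∀ c, exceptionalPairs (C.labelGraph c) p c = exceptionalPairs (C'.labelGraph c) p c)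
    (hK : successorGraph C p = successorGraph C' p) : C = C' := by
  refine SimpleGraph.EdgeLabeling.ext_get fun u v huv => ?_
  set a := C.get u v huv with ha
  set b := C'.get u v huv with hb
  have adj : ∀ (D : G.EdgeLabeling (Fin 3)) c, (D.labelGraph c).Adj u v ↔ D.get u v huv = c :=
    fun D c => by
      rw [SimpleGraph.EdgeLabeling.labelGraph_adj]
      exact ⟨fun ⟨_, h⟩ => h, fun h => ⟨huv, h⟩⟩
  have hexc : ∀ c, (a = c ∧ (p u = none ∨ p u = some c ∨ p v = none ∨ p v = some c)) ↔
      (b = c ∧ (p u = none ∨ p u = some c ∨ p v = none ∨ p v = some c)) := fun c => by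
    have := congrArg (fun S => (u, v) ∈ S) (hX c)
    simpa [exceptionalPairs, adj, ← ha, ← hb] using this
  have hsucc : (∃ c, p u = some c ∧ p v = some c ∧ a = c + 1) ↔
      (∃ c, p u = some c ∧ p v = some c ∧ b = c + 1) := by
    have := congrArg (fun L : SimpleGraph V => L.Adj u v) hK
    simpa [successorGraph, adj, ← ha, ← hb] using this
  clear_value a b
  generalize p u = x at hexc hsucc
  generalize p v = y at hexc hsucc
  rcases x with _ | x
  · exact ((hexc a).1 ⟨rfl, Or.inl rfl⟩).1.symm
  rcases y with _ | y
  · exact ((hexc a).1 ⟨rfl, Or.inr (Or.inr (Or.inl rfl))⟩).1.symm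
  -- Both ends are assigned now. If a or b is the color of an end, `hexc` gives a = b; otherwise
  -- distinct classes leave one color and equal classes leave two, separated by `hsucc`.
  simp only [reduceCtorEq, Option.some.injEq, false_or] at hexc hsucc
  clear ha hb hX hK adj
  revert x y a b
  decide

/-- The number of colorings without monochromatic triangles of an `n`-vertex graph with small
independence number. -/
theorem numMonoCliqueFreeColorings_le {n : ℕ} {G : SimpleGraph (Fin n)} {γ : ℝ} (hγ : 0 < γ)
    (hG : (G.indepNum : ℝ) ≤ γ ^ 4 * n) :
    numMonoCliqueFreeColorings 3 3 G ≤ 4 ^ n *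
      Nat.card {s : Finset (Fin n × Fin n) // (#s : ℝ) ≤
        4 * γ * Fintype.card (Fin n × Fin n)} ^ 3 * numTriangleFree n := by
  classical
  have hcard : Nat.card ((Fin n → Option (Fin 3)) ×
      (Fin 3 → {s : Finset (Fin n × Fin n) // (#s : ℝ) ≤
        4 * γ * Fintype.card (Fin n × Fin n)}) × {H : SimpleGraph (Fin n) // H.CliqueFree 3}) =
      4 ^ n * Nat.card {s : Finset (Fin n × Fin n) // (#s : ℝ) ≤
        4 * γ * Fintype.card (Fin n × Fin n)} ^ 3 * numTriangleFree n := by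
    rw [Nat.card_prod, Nat.card_prod, Nat.card_fun, Nat.card_fun, numTriangleFree]
    simp [mul_assoc]
  rw [← hcard, numMonoCliqueFreeColorings]
  choose p hp₁ hp₂ using fun C : {C : G.EdgeLabeling (Fin 3) //
    ∀ c, (C.labelGraph c).CliqueFree 3} =>
      exists_color_assignment C.1 C.2 hγ (by rwa [Fintype.card_fin])
  refine Nat.card_le_card_of_injective (fun C => (p C,
    fun c => ⟨exceptionalPairs (C.1.labelGraph c) (p C) c, ?_⟩,
    ⟨successorGraph C.1 (p C), successorGraph_cliqueFree C.2 _⟩)) fun C C' h => ?_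
  · refine (card_exceptionalPairs_le _ _ _ (hp₁ C) (hp₂ C c)).trans (le_of_eq ?_)
    rw [Fintype.card_prod]
    push_cast
    ring
  · simp only [Prod.mk.injEq, Subtype.mk.injEq, funext_iff] at h
    obtain ⟨h₁, h₂, h₃⟩ := h
    have h₁ : p C = p C' := funext h₁
    rw [← h₁] at h₂ h₃
    exact Subtype.ext (edgeLabeling_eq_of_exceptionalPairs_eq (p C) h₂ h₃)

/-! ### The two bounds on RF. -/

theorem exists_numMonoCliqueFreeColorings_le {η : ℝ} (hη : 0 < η) :
    ∃ ε₀ : ℝ, 0 < ε₀ ∧ ∃ n₀ : ℕ, ∀ n : ℕ, n₀ ≤ n → ∀ G : SimpleGraph (Fin n),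
      (G.indepNum : ℝ) ≤ ε₀ * n →
      (numMonoCliqueFreeColorings 3 3 G : ℝ) ≤ 2 ^ ((n : ℝ) ^ 2 / 4 + η * (n : ℝ) ^ 2) := by
  -- Budget for η: 3·η/12 for the exceptional sets, η/4 for triangle-free graphs, η/2 for the
  -- lower-order terms 2n + D.
  obtain ⟨γ, hγ, hsmall⟩ := exists_card_finset_card_le (show 0 < η / 12 by positivity)
  obtain ⟨D, hD⟩ := exists_numTriangleFree_le_two_rpow (show 0 < η / 4 by positivity)
  obtain ⟨n₁, hn₁⟩ := exists_nat_ge ((2 + |D|) / (η / 2))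
  refine ⟨(γ / 4) ^ 4, by positivity, n₁ + 1, fun n hn G hG => ?_⟩
  have hn1 : (1 : ℝ) ≤ n := by exact_mod_cast (by omega : 1 ≤ n)
  have hlin : 2 + |D| ≤ η / 2 * n := by
    rw [div_le_iff₀ (by positivity)] at hn₁
    have : (n₁ : ℝ) ≤ n := by exact_mod_cast (by omega : n₁ ≤ n)
    nlinarith
  have hquad : 2 * n + D ≤ η / 2 * (n : ℝ) ^ 2 := by
    have h1 := mul_le_mul_of_nonneg_right hlin (show (0 : ℝ) ≤ n by positivity)
    have h2 : |D| * 1 ≤ |D| * n := mul_le_mul_of_nonneg_left hn1 (abs_nonneg D)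
    have h3 := le_abs_self D
    nlinarith
  have hX := hsmall (Fin n × Fin n)
  have hcard : (Fintype.card (Fin n × Fin n) : ℝ) = (n : ℝ) ^ 2 := by simp [sq]
  have h4 : (4 : ℝ) ^ n = 2 ^ (2 * (n : ℝ)) := by
    rw [Real.rpow_mul two_pos.le, Real.rpow_natCast]
    norm_num
  calc (numMonoCliqueFreeColorings 3 3 G : ℝ) ≤ 4 ^ n *
        (Nat.card {s : Finset (Fin n × Fin n) // (#s : ℝ) ≤
          γ * Fintype.card (Fin n × Fin n)} : ℝ) ^ 3 * numTriangleFree n := by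
        have h := numMonoCliqueFreeColorings_le (div_pos hγ four_pos) hG
        rw [mul_div_cancel₀ _ (four_ne_zero' ℝ)] at h
        exact_mod_cast h
    _ ≤ 2 ^ (2 * (n : ℝ)) * ((2 : ℝ) ^ (η / 12 * (n : ℝ) ^ 2)) ^ 3 *
        2 ^ ((1 / 4 + η / 4) * (n : ℝ) ^ 2 + D) := by
        rw [h4, ← hcard]
        gcongr
        rw [hcard]
        exact hD n
    _ = 2 ^ (2 * (n : ℝ) + η / 12 * (n : ℝ) ^ 2 * 3 + ((1 / 4 + η / 4) * (n : ℝ) ^ 2 + D)) := by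
        rw [← Real.rpow_mul_natCast two_pos.le, ← Real.rpow_add two_pos, ← Real.rpow_add two_pos]
        norm_num
    _ ≤ 2 ^ ((n : ℝ) ^ 2 / 4 + η * (n : ℝ) ^ 2) :=
        Real.rpow_le_rpow_of_exponent_le one_le_two (by linarith)

/-- `RF(3, 3, o(n)) = 2 ^ (n ^ 2 / 4 + o(n ^ 2))`. -/
theorem theorem5p1 :
    ∀ η : ℝ, 0 < η → ∃ ε₀ : ℝ, 0 < ε₀ ∧ ∀ ε : ℝ, 0 < ε → ε ≤ ε₀ →
      ∃ n₀ : ℕ, ∀ n : ℕ, n₀ ≤ n →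
        (2 : ℝ) ^ ((n : ℝ) ^ 2 / 4 - η * (n : ℝ) ^ 2) ≤ (RF 3 3 (fun m => ε * (m : ℝ)) n : ℝ) ∧
        (RF 3 3 (fun m => ε * (m : ℝ)) n : ℝ) ≤ (2 : ℝ) ^ ((n : ℝ) ^ 2 / 4 + η * (n : ℝ) ^ 2) := by
  intro η hη
  obtain ⟨ε₀, hε₀, n₁, hup⟩ := exists_numMonoCliqueFreeColorings_le hη
  refine ⟨ε₀, hε₀, fun ε hε hεε₀ => ?_⟩
  obtain ⟨n₂, hlow⟩ := exists_indepNum_le_two_pow_le hε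
  obtain ⟨n₃, hn₃⟩ := exists_nat_ge (1 / (2 * η))
  refine ⟨n₁ + n₂ + n₃, fun n hn => ?_⟩
  obtain ⟨G, hG, hGcol⟩ := hlow n (by omega)
  -- The lower bound graph also shows that the supremum is attained, so the upper bound need only be
  -- applied to an extremal graph.
  obtain ⟨⟨K, hK, hKcol⟩, hmax⟩ := RF_isGreatest 3 3 (fun m => ε * (m : ℝ)) n ⟨G, hG⟩
  constructor
  · have hle : 2 ^ (n / 2) ^ 2 ≤ RF 3 3 (fun m => ε * (m : ℝ)) n :=
      hGcol.trans (hmax ⟨G, hG, rfl⟩)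
    calc (2 : ℝ) ^ ((n : ℝ) ^ 2 / 4 - η * (n : ℝ) ^ 2)
        ≤ 2 ^ (((n / 2 : ℕ) : ℝ) ^ 2) := by
          refine Real.rpow_le_rpow_of_exponent_le one_le_two ?_
          have h1 : (n : ℝ) ≤ 2 * (n / 2 : ℕ) + 1 := by
            exact_mod_cast (by omega : n ≤ 2 * (n / 2) + 1)
          have h2 : 1 ≤ 2 * η * n := by
            rw [div_le_iff₀ (by positivity)] at hn₃
            have : (n₃ : ℝ) ≤ n := by exact_mod_cast (by omega : n₃ ≤ n)
            nlinarith
          have h3 : (n : ℝ) ≤ 2 * η * n * n := le_mul_of_one_le_left (Nat.cast_nonneg n) h2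
          -- Squaring n - 1 ≤ 2⌊n/2⌋ requires n ≥ 1.
          rcases Nat.eq_zero_or_pos n with rfl | hn0
          · simp
          have hn1 : (1 : ℝ) ≤ n := by exact_mod_cast hn0
          have h4 : ((n : ℝ) - 1) ^ 2 ≤ (2 * (n / 2 : ℕ)) ^ 2 :=
            pow_le_pow_left₀ (by linarith) (by linarith) 2
          nlinarith
      _ = ((2 ^ (n / 2) ^ 2 : ℕ) : ℝ) := by
          rw [← Nat.cast_pow, Real.rpow_natCast]
          push_cast
          rfl
      _ ≤ _ := by exact_mod_cast hle
  · rw [← hKcol]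
    refine hup n (by omega) K (hK.trans ?_)
    exact mul_le_mul_of_nonneg_right hεε₀ (Nat.cast_nonneg n)
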